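/- All graphs are finite and simple. For a graph $G$ on $n$ vertices $1,\dots,n$ and an integer $t\ge 2$, the $t$-clique tensor of $G$ is the order $t$, dimension $n$ tensor $\mathcal A(G)=(a_{i_1\cdots i_t})$ with $a_{i_1\cdots i_t}=\frac1{(t-1)!}$ if $\{i_1,\dots,i_t\}$ is a set of $t$ distinct, pairwise adjacent vertices of $G$, and $a_{i_1\cdots i_t}=0$ otherwise. A number $\lambda\in\mathbb C$ is an eigenvalue of $\mathcal A(G)$ if there is a nonzero vector $x\in\mathbb C^n$ such that $$\lambda x_i^{t-1}=\sum_{i_2,\dots,i_t=1}^n a_{i i_2\cdots i_t}\,x_{i_2}\cdots x_{i_t}\qquad (i=1,\dots,n).$$ The $t$-clique spectral radius $\rho_t(G)$ is the maximum modulus of the eigenvalues of $\mathcal A(G)$. Let $T_r(n)$ denote the Turán graph, that is, the complete $r$-partite graph on $n$ vertices whose part sizes differ by at most one. A graph is $H$-free if it has no (not necessarily induced) subgraph isomorphic to $H$. **Theorem.** Let $r,t$ be integers and let $H$ be a graph with chromatic number $\chi(H)=r+1>t\ge 2$. For every $\varepsilon>0$ there exist $\delta>0$ and $n_0$ such that the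 following holds: if $G$ is an $H$-free graph on $n\ge n_0$ vertices and $$\rho_t(G)\ \ge\ \left(\binom{r-1}{t-1}\left(\frac1r\right)^{t-1}-\delta\right)n^{t-1},$$ then $G$ can be obtained from (a copy of) $T_r(n)$ by adding and deleting at most $\varepsilon n^2$ edges in total. -/

import Mathlib

open scoped symmDiff

namespace CliqueTensor

/-- A complex tensor of order `m` whose indices range over `ι` (its dimension is the number of
elements of `ι`). -/
abbrev Tensor (m : ℕ) (ι : Type*) := (Fin m → ι) → ℂ

/-- `c` is an eigenvalue of the tensor `A` of order `k + 1`: there is a nonzero complex vector `x`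
with `c * x_i ^ k = ∑_{j_1, …, j_k} a_{i j_1 ⋯ j_k} x_{j_1} ⋯ x_{j_k}` for every index `i`. -/
def IsEigenvalue {ι : Type*} [Fintype ι] {k : ℕ} (A : Tensor (k + 1) ι) (c : ℂ) : Prop :=
  ∃ x : ι → ℂ, x ≠ 0 ∧
    ∀ i : ι, c * x i ^ k = ∑ j : Fin k → ι, A (Fin.cons i j) * ∏ l : Fin k, x (j l)

/-- The spectral radius of a tensor of order `k + 1`: the largest modulus of its eigenvalues. -/
noncomputable def spectralRadius {ι : Type*} [Fintype ι] {k : ℕ} (A : Tensor (k + 1) ι) : ℝ :=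
  sSup {s : ℝ | ∃ c : ℂ, IsEigenvalue A c ∧ s = ‖c‖}

open Classical in
/-- The `t`-clique tensor of a graph: the entry at `(i_1, …, i_t)` is `1 / (t - 1)!` if
`{i_1, …, i_t}` is a clique with exactly `t` vertices, and `0` otherwise. -/
noncomputable def cliqueTensor {V : Type*} (G : SimpleGraph V) (t : ℕ) : Tensor t V :=
  fun i => if Finset.univ.image i ∈ G.cliqueSet t then 1 / ((t - 1).factorial : ℂ) else 0

/-- The `t`-clique spectral radius `ρ_t(G)`, for `t ≥ 1` (the value at `t = 0` is a dummy). -/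
noncomputable def cliqueSpectralRadius {V : Type*} [Fintype V] (G : SimpleGraph V) : ℕ → ℝ
  | 0 => 0
  | k + 1 => spectralRadius (cliqueTensor G (k + 1))

/-- `G` can be obtained from (a copy on its own vertex set of) the graph `T` by adding and deleting
at most `b` edges in total. -/
def ObtainedByEdits {V W : Type*} (G : SimpleGraph V) (T : SimpleGraph W) (b : ℝ) : Prop :=
  ∃ T' : SimpleGraph V, Nonempty (T' ≃g T) ∧
    (T'.edgeSet ∆ G.edgeSet).Finite ∧ ((T'.edgeSet ∆ G.edgeSet).ncard : ℝ) ≤ b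

end CliqueTensor

/-! Replace an eigenvector by the moduli of its entries, scaled to total weight 1. With this vertex
weight `w`, the modulus of the eigenvalue times `(t-1)! * ∑ w^t` is at most `p_t`, the weighted
count of ordered `t`-cliques (`IsEigenvalue.exists_weight`).

For every such weight the counts `p_s` satisfy the Moon–Moser inequalities (`moon_moser`). If
`p_{r+1} = 0`, these bound `p_t` by its Turán value, with equality only if `p_2 = 1 - 1/r`. The
admissible sequences form a compact set, so an approximate version follows without explicit
constants (`exists_moonMoser_stability`). It applies because an `H`-free graph has few
`(r+1)`-cliques (`pow_cliqueSum_le_of_free`).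

Since `n^(t-1) * ∑ w^t` is at least 1 plus the mean square deviation of `w` from the uniform weight,
a large spectral radius forces `w` to be nearly uniform. Hence `G` itself has edge density nearly `1
- 1/r` (`exists_le_cliqueSum_two`).

Near equality in Moon–Moser for uniform weights then yields an `r`-clique for which almost every
vertex misses exactly one member. Sorting the vertices by a missed member gives `r` classes with few
inner edges (`exists_colouring_of_ratio`). Counting pairs shows that the classes are nearly equal
and nearly all cross edges are present (`exists_obtainedByEdits`). -/

namespace CliqueTensor

/-! ### Weighted clique counts and the Moon–Moser inequality. -/

section CliqueSums

open Finset
open scoped Classical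

variable {V : Type*} (G : SimpleGraph V) (w : V → ℝ) {s m : ℕ}

/-- A tuple of pairwise adjacent vertices. -/
def IsCliqueTuple (c : Fin s → V) : Prop := ∀ i j, i ≠ j → G.Adj (c i) (c j)

/-- The vertex `x` is adjacent to all members of the tuple `c`. -/
def IsCommonNbr (c : Fin s → V) (x : V) : Prop := ∀ i, G.Adj x (c i)

/-- The vertex `x` is adjacent to all members of the tuple `c` but one. -/
def MissesOne (c : Fin (m + 1) → V) (x : V) : Prop :=
  ∃ i : Fin (m + 1), IsCommonNbr G (i.removeNth c) x ∧ ¬ G.Adj x (c i)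

/-- The product of the weights of a clique tuple, and `0` for other tuples. -/
noncomputable def tupleWeight (c : Fin s → V) : ℝ :=
  if IsCliqueTuple G c then ∏ i, w (c i) else 0

variable {G w}

lemma isCliqueTuple_insertNth (i : Fin (s + 1)) (x : V) (c : Fin s → V) :
    IsCliqueTuple G (i.insertNth x c : Fin (s + 1) → V) ↔
      IsCommonNbr G c x ∧ IsCliqueTuple G c := by
  constructor
  · intro h
    refine ⟨fun j => ?_, fun j k hjk => ?_⟩
    · simpa using h i (i.succAbove j) (Fin.succAbove_ne i j).symm
    · simpa using h (i.succAbove j) (i.succAbove k) (by simpa using hjk)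
  · rintro ⟨h1, h2⟩ j k hjk
    obtain hj | ⟨j, rfl⟩ := Fin.eq_self_or_eq_succAbove i j <;>
      obtain hk | ⟨k, rfl⟩ := Fin.eq_self_or_eq_succAbove i k
    · exact absurd (hj.trans hk.symm) hjk
    · simpa [hj] using h1 k
    · simpa [hk] using (h1 j).symm
    · simpa using h2 j k (by simpa using hjk)

lemma tupleWeight_insertNth (i : Fin (s + 1)) (x : V) (c : Fin s → V) :
    tupleWeight G w (i.insertNth x c : Fin (s + 1) → V) =
      tupleWeight G w c * if IsCommonNbr G c x then w x else 0 := by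
  unfold tupleWeight
  rw [isCliqueTuple_insertNth, Fin.prod_univ_succAbove _ i]
  by_cases h1 : IsCommonNbr G c x <;> by_cases h2 : IsCliqueTuple G c <;>
    simp [h1, h2, mul_comm]

lemma tupleWeight_nonneg (hw : ∀ x, 0 ≤ w x) (c : Fin s → V) : 0 ≤ tupleWeight G w c := by
  unfold tupleWeight
  split_ifs
  · exact prod_nonneg fun i _ => hw _
  · exact le_rfl

lemma isCommonNbr_iff_removeNth (i : Fin (m + 1)) (c : Fin (m + 1) → V) (x : V) :
    IsCommonNbr G c x ↔ IsCommonNbr G (i.removeNth c) x ∧ G.Adj x (c i) := by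
  constructor
  · exact fun h => ⟨fun j => h _, h i⟩
  · rintro ⟨h1, h2⟩ j
    rcases Fin.eq_self_or_eq_succAbove i j with rfl | ⟨j, rfl⟩
    exacts [h2, h1 j]

/-- A common neighbour of the whole tuple is counted once for each subtuple, a vertex missing
exactly one member only for the subtuple without that member, and any other vertex never. -/
lemma sum_isCommonNbr_removeNth (c : Fin (m + 1) → V) (x : V) :
    (∑ i : Fin (m + 1), if IsCommonNbr G (i.removeNth c) x then (1 : ℝ) else 0) =
      (if MissesOne G c x then 1 else 0) + (m + 1) * if IsCommonNbr G c x then 1 else 0 := by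
  by_cases h : IsCommonNbr G c x
  · have h' : ¬ MissesOne G c x := fun ⟨i, _, hi⟩ => hi (h i)
    have h'' : ∀ i : Fin (m + 1), IsCommonNbr G (i.removeNth c) x := fun i j => h _
    simp [h, h', h'']
  · by_cases h' : MissesOne G c x
    · obtain ⟨i, hi, hix⟩ := id h'
      rw [sum_eq_single i]
      · simp [hi, h, h']
      · intro j _ hj
        rw [if_neg]
        intro hj'
        obtain ⟨k, rfl⟩ := Fin.exists_succAbove_eq hj.symm
        exact hix (hj' k)
      · simp
    · have : ∀ i : Fin (m + 1), ¬ IsCommonNbr G (i.removeNth c) x := fun i hi => by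
        by_cases hx : G.Adj x (c i)
        · exact h ((isCommonNbr_iff_removeNth i c x).2 ⟨hi, hx⟩)
        · exact h' ⟨i, hi, hx⟩
      simp [h, h', this]

variable [Fintype V]

variable (G w) in
/-- The total weight of the common neighbours of a tuple. -/
noncomputable def nbrWeight (c : Fin s → V) : ℝ := ∑ x, if IsCommonNbr G c x then w x else 0

variable (G w) in
/-- The total weight of the ordered cliques with `s` vertices. -/
noncomputable def cliqueSum (s : ℕ) : ℝ := ∑ c : Fin s → V, tupleWeight G w c

lemma sum_insertNth (i : Fin (s + 1)) (F : (Fin (s + 1) → V) → ℝ) :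
    ∑ c, F c = ∑ c : Fin s → V, ∑ x, F (i.insertNth x c) := by
  rw [sum_comm, ← Fintype.sum_prod_type']
  exact (Fintype.sum_equiv (Fin.insertNthEquiv (fun _ => V) i) _ _ fun p => rfl).symm

/-- Every `(s+1)`-clique is an `s`-clique with a common neighbour inserted at position `i`; this is
the double count behind Moon–Moser. -/
lemma sum_tupleWeight_removeNth (i : Fin (s + 1)) (Φ : (Fin s → V) → V → ℝ) :
    ∑ c, tupleWeight G w c * Φ (i.removeNth c) (c i) =
      ∑ c : Fin s → V, tupleWeight G w c *
        ∑ x, (if IsCommonNbr G c x then w x else 0) * Φ c x := by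
  rw [sum_insertNth i]
  refine sum_congr rfl fun c _ => ?_
  rw [mul_sum]
  refine sum_congr rfl fun x _ => ?_
  rw [tupleWeight_insertNth]
  simp [mul_assoc]

lemma sum_tupleWeight_removeNth_const (i : Fin (s + 1)) (Φ : (Fin s → V) → ℝ) :
    ∑ c, tupleWeight G w c * Φ (i.removeNth c) =
      ∑ c : Fin s → V, tupleWeight G w c * nbrWeight G w c * Φ c := by
  rw [sum_tupleWeight_removeNth i fun c _ => Φ c]
  simp_rw [← sum_mul, nbrWeight, mul_assoc]

lemma cliqueSum_succ (s : ℕ) :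
    cliqueSum G w (s + 1) = ∑ c : Fin s → V, tupleWeight G w c * nbrWeight G w c := by
  simpa [cliqueSum] using sum_tupleWeight_removeNth_const (G := G) (w := w) 0 fun _ => 1

@[simp] lemma cliqueSum_zero : cliqueSum G w 0 = 1 := by
  simp [cliqueSum, tupleWeight, IsCliqueTuple]

lemma cliqueSum_one : cliqueSum G w 1 = ∑ x, w x := by
  rw [cliqueSum_succ]
  simp [tupleWeight, IsCliqueTuple, nbrWeight, IsCommonNbr]

lemma nbrWeight_le_one (hw : ∀ x, 0 ≤ w x) (h1 : ∑ x, w x = 1) (c : Fin s → V) :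
    nbrWeight G w c ≤ 1 :=
  h1 ▸ sum_le_sum fun x _ => by split_ifs; exacts [le_rfl, hw x]

lemma cliqueSum_nonneg (hw : ∀ x, 0 ≤ w x) (s : ℕ) : 0 ≤ cliqueSum G w s :=
  sum_nonneg fun c _ => tupleWeight_nonneg hw c

lemma cliqueSum_succ_le (hw : ∀ x, 0 ≤ w x) (h1 : ∑ x, w x = 1) (s : ℕ) :
    cliqueSum G w (s + 1) ≤ cliqueSum G w s := by
  rw [cliqueSum_succ]
  exact sum_le_sum fun c _ => mul_le_of_le_one_right (tupleWeight_nonneg hw c)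
    (nbrWeight_le_one hw h1 c)

lemma cliqueSum_smul (a : ℝ) (s : ℕ) :
    cliqueSum G (fun x => a * w x) s = a ^ s * cliqueSum G w s := by
  unfold cliqueSum tupleWeight
  rw [mul_sum]
  refine sum_congr rfl fun c _ => ?_
  split_ifs <;> simp [prod_mul_distrib]

lemma sum_nbrWeight_removeNth (c : Fin (m + 1) → V) :
    ∑ i : Fin (m + 1), nbrWeight G w (i.removeNth c) =
      (∑ x, if MissesOne G c x then w x else 0) + (m + 1) * nbrWeight G w c := by
  unfold nbrWeight
  rw [sum_comm, mul_sum, ← sum_add_distrib]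
  refine sum_congr rfl fun x _ => ?_
  have := congrArg (· * w x) (sum_isCommonNbr_removeNth (G := G) c x)
  simp only [sum_mul, add_mul, mul_assoc, ite_mul, one_mul, zero_mul] at this
  rw [this, add_mul, one_mul]

lemma missesOne_add_nbrWeight_le (hw : ∀ x, 0 ≤ w x) (h1 : ∑ x, w x = 1)
    (c : Fin (m + 1) → V) :
    (∑ x, if MissesOne G c x then w x else 0) + nbrWeight G w c ≤ 1 := by
  unfold nbrWeight
  rw [← sum_add_distrib, ← h1]
  refine sum_le_sum fun x _ => ?_
  by_cases h : IsCommonNbr G c x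
  · have h' : ¬ MissesOne G c x := fun ⟨i, _, hi⟩ => hi (h i)
    simp [h, h']
  · split_ifs <;> simp [hw x]

/-- The sum over the `(m + 1)`-cliques of the weights of the common neighbourhoods of their
`m`-subcliques, bounded from below. -/
lemma cliqueSum_sq_le_sum (hw : ∀ x, 0 ≤ w x) (m : ℕ) :
    (m + 1) * cliqueSum G w (m + 1) ^ 2 ≤ cliqueSum G w m *
      ∑ c : Fin (m + 1) → V, tupleWeight G w c *
        ∑ i : Fin (m + 1), nbrWeight G w (i.removeNth c) := by
  have key : ∑ c : Fin (m + 1) → V, tupleWeight G w c *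
        ∑ i : Fin (m + 1), nbrWeight G w (i.removeNth c) =
      (m + 1) * ∑ c : Fin m → V, tupleWeight G w c * nbrWeight G w c ^ 2 := by
    simp_rw [mul_sum]
    rw [sum_comm]
    simp_rw [← mul_sum]
    have : ∀ i : Fin (m + 1), ∑ c, tupleWeight G w c * nbrWeight G w (i.removeNth c) =
        ∑ c : Fin m → V, tupleWeight G w c * nbrWeight G w c ^ 2 := fun i => by
      rw [sum_tupleWeight_removeNth_const i]
      simp [sq, mul_assoc]
    simp [this]
  -- Cauchy–Schwarz over `m`-cliques: the second moment of `nbrWeight` is bounded below by its first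
  -- moment, which is `cliqueSum G w (m + 1)`.
  have cs := sum_sq_le_sum_mul_sum_of_sq_le_mul (univ : Finset (Fin m → V))
    (r := fun c => tupleWeight G w c * nbrWeight G w c)
    (f := fun c => tupleWeight G w c)
    (g := fun c => tupleWeight G w c * nbrWeight G w c ^ 2)
    (fun c _ => tupleWeight_nonneg hw c)
    (fun c _ => mul_nonneg (tupleWeight_nonneg hw c) (sq_nonneg _))
    (fun c _ => le_of_eq (by ring))
  rw [key, cliqueSum_succ]
  calc _ ≤ ((m : ℝ) + 1) * _ := mul_le_mul_of_nonneg_left cs (by positivity)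
    _ = _ := by unfold cliqueSum; ring

/-- The Moon–Moser inequality for weighted graphs. -/
theorem moon_moser (hw : ∀ x, 0 ≤ w x) (h1 : ∑ x, w x = 1) (m : ℕ) :
    (m + 1) * cliqueSum G w (m + 1) ^ 2 ≤
      cliqueSum G w m * (cliqueSum G w (m + 1) + m * cliqueSum G w (m + 2)) := by
  refine (cliqueSum_sq_le_sum hw m).trans
    (mul_le_mul_of_nonneg_left ?_ (cliqueSum_nonneg hw m))
  rw [cliqueSum_succ (m + 1), mul_sum, cliqueSum, ← sum_add_distrib]
  refine sum_le_sum fun c _ => ?_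
  rw [sum_nbrWeight_removeNth]
  have := mul_le_mul_of_nonneg_left (missesOne_add_nbrWeight_le (G := G) hw h1 c)
    (tupleWeight_nonneg (G := G) hw c)
  nlinarith [this]

end CliqueSums

/-! ### Extremal behaviour and stability of sequences obeying Moon–Moser. -/

section MoonMoserSequences

/-- On a compact set, if the constraint `φ ≤ 0` forces `ψ < 0`, then so does a slightly relaxed
constraint `φ ≤ η`. -/
lemma exists_pos_of_isCompact {X : Type*} [TopologicalSpace X] {K : Set X} (hK : IsCompact K)
    {φ ψ : X → ℝ} (hφ : Continuous φ) (hψ : Continuous ψ)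
    (h : ∀ p ∈ K, φ p ≤ 0 → ψ p < 0) :
    ∃ η : ℝ, 0 < η ∧ ∀ p ∈ K, φ p ≤ η → ψ p < 0 := by
  have hS : IsCompact (K ∩ {p | 0 ≤ ψ p}) :=
    hK.inter_right (isClosed_le continuous_const hψ)
  rcases (K ∩ {p | 0 ≤ ψ p}).eq_empty_or_nonempty with he | hne
  · refine ⟨1, one_pos, fun p hp _ => not_le.1 fun hp' => ?_⟩
    exact (Set.eq_empty_iff_forall_notMem.1 he p) ⟨hp, hp'⟩
  · obtain ⟨p₀, ⟨hp₀, hp₀'⟩, hmin⟩ := hS.exists_isMinOn hne hφ.continuousOn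
    have hpos : 0 < φ p₀ := not_le.1 fun hle => (h p₀ hp₀ hle).not_ge hp₀'
    refine ⟨φ p₀ / 2, half_pos hpos, fun p hp hle => not_le.1 fun hp' => ?_⟩
    have : φ p₀ ≤ φ p := hmin ⟨hp, hp'⟩
    linarith

/-- Sequences that satisfy the elementary relations between the clique densities of a weighted
graph. -/
def moonMoserSet : Set (ℕ → ℝ) :=
  {p | p 0 = 1 ∧ p 1 = 1 ∧ (∀ s, 0 ≤ p s) ∧ (∀ s, p (s + 1) ≤ p s) ∧
    ∀ m : ℕ, (m + 1) * p (m + 1) ^ 2 ≤ p m * (p (m + 1) + m * p (m + 2))}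

lemma le_one_of_mem_moonMoserSet {p : ℕ → ℝ} (hp : p ∈ moonMoserSet) (s : ℕ) : p s ≤ 1 := by
  obtain ⟨h0, -, -, h3, -⟩ := hp
  induction s with
  | zero => exact h0.le
  | succ s ih => exact (h3 s).trans ih

lemma isCompact_moonMoserSet : IsCompact moonMoserSet := by
  -- Tychonoff: each constraint involves finitely many coordinates, so it is closed in the product
  -- topology.
  have hK : IsCompact (Set.univ.pi fun _ : ℕ => Set.Icc (0 : ℝ) 1) :=
    isCompact_univ_pi fun _ => isCompact_Icc
  refine hK.of_isClosed_subset ?_ fun p hp s _ =>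
    ⟨hp.2.2.1 s, le_one_of_mem_moonMoserSet hp s⟩
  simp only [moonMoserSet, Set.ofPred_and, Set.ofPred_forall]
  refine (isClosed_eq (by fun_prop) (by fun_prop)).inter
    ((isClosed_eq (by fun_prop) (by fun_prop)).inter
    ((isClosed_iInter fun s => isClosed_le (by fun_prop) (by fun_prop)).inter
    ((isClosed_iInter fun s => isClosed_le (by fun_prop) (by fun_prop)).inter
    (isClosed_iInter fun s => isClosed_le (by fun_prop) (by fun_prop)))))

/-- The density of ordered `t`-cliques in a large balanced complete `r`-partite graph. -/
noncomputable def turanDensity (r t : ℕ) : ℝ := ∏ s ∈ Finset.range t, (1 - (s : ℝ) / r)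

lemma turanDensity_succ (r t : ℕ) :
    turanDensity r (t + 1) = (1 - (t : ℝ) / r) * turanDensity r t := by
  rw [turanDensity, Finset.prod_range_succ, mul_comm, turanDensity]

lemma turanDensity_two (r : ℕ) : turanDensity r 2 = 1 - 1 / r := by
  simp [turanDensity, Finset.prod_range_succ]

lemma turanDensity_pos {r t : ℕ} (h : t ≤ r) : 0 < turanDensity r t := by
  refine Finset.prod_pos fun s hs => ?_
  have hs' : (s : ℝ) < r := by exact_mod_cast (Finset.mem_range.1 hs).trans_le h
  have : (s : ℝ) / r < 1 := (div_lt_one (by linarith [Nat.cast_nonneg (α := ℝ) s])).2 hs'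
  linarith

lemma turanDensity_eq {r k : ℕ} (h : k < r) :
    turanDensity r (k + 1) = k.factorial * (((r - 1).choose k : ℝ) * (1 / (r : ℝ)) ^ k) := by
  have hr : (r : ℝ) ≠ 0 := by exact_mod_cast (by omega : r ≠ 0)
  induction k with
  | zero => simp [turanDensity]
  | succ k ih =>
    rw [turanDensity_succ, ih (by omega)]
    have h1 : ((r - 1).choose (k + 1) : ℝ) * (k + 1) = (r - 1).choose k * (r - 1 - k) := by
      have := Nat.choose_succ_right_eq (r - 1) k
      have h2 : ((r - 1 - k : ℕ) : ℝ) = r - 1 - k := by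
        rw [Nat.cast_sub (by omega), Nat.cast_sub (by omega)]; simp
      rw [← h2]
      exact_mod_cast this
    rw [Nat.factorial_succ]
    push_cast
    calc _ = k.factorial * (1 / (r : ℝ)) ^ (k + 1) * ((r - 1).choose k * (r - 1 - k)) := by
          simp only [one_div, inv_pow, pow_succ]
          field_simp
          ring
      _ = _ := by rw [← h1]; ring

variable {p : ℕ → ℝ} {r : ℕ}

/-- Descending induction from `j = r`, where the factor vanishes. The step rests on `1 + j(1 -
(j+1)/r) = (j+1)(1 - j/r)`. -/
lemma moonMoser_ratio_le (hp : p ∈ moonMoserSet) (hr : 1 ≤ r) (h : p (r + 1) ≤ 0) {j : ℕ}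
    (hj : j ≤ r) : p (j + 1) ≤ (1 - (j : ℝ) / r) * p j := by
  obtain ⟨-, -, h2, h3, h4⟩ := hp
  have hr' : (0 : ℝ) < r := by exact_mod_cast hr
  induction hj using Nat.decreasingInduction with
  | self => simpa [hr'.ne'] using h
  | of_succ j hj ih =>
    have hj1 : (j : ℝ) / r ≤ 1 := (div_le_one hr').2 (by exact_mod_cast hj.le)
    rcases (h2 (j + 1)).eq_or_lt with h0 | h0
    · rw [← h0]
      exact mul_nonneg (by linarith) (h2 j)
    · have h5 : (j + 1) * p (j + 1) ^ 2 ≤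
          p j * (p (j + 1) + j * ((1 - ((j + 1 : ℕ) : ℝ) / r) * p (j + 1))) :=
        (h4 j).trans (by gcongr; exact h2 j)
      have h6 : ((j : ℝ) + 1) * p (j + 1) * p (j + 1) ≤
          ((j : ℝ) + 1) * p (j + 1) * ((1 - (j : ℝ) / r) * p j) := by
        refine (by ring : _ = ((j : ℝ) + 1) * p (j + 1) ^ 2).trans_le (h5.trans_eq ?_)
        push_cast
        field_simp
        ring
      exact le_of_mul_le_mul_left h6 (by positivity)

/-- The same identity, now used upwards: a large edge density propagates to all later ratios. -/
lemma moonMoser_ratio_ge (hp : p ∈ moonMoserSet) (hr : 2 ≤ r) (h : 1 - 1 / (r : ℝ) ≤ p 2) {j : ℕ}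
    (hj : j < r) : (1 - (j : ℝ) / r) * p j ≤ p (j + 1) ∧ 0 < p (j + 1) := by
  obtain ⟨h0, h1, h2, h3, h4⟩ := hp
  have hr' : (0 : ℝ) < r := by positivity
  induction j with
  | zero => simp [h0, h1]
  | succ j ih =>
    rcases Nat.eq_zero_or_pos j with rfl | hj0
    · have : 1 / (r : ℝ) < 1 := by rw [div_lt_one hr']; exact_mod_cast hr
      simp only [zero_add, h1, Nat.cast_one, mul_one]
      exact ⟨h, by linarith⟩
    obtain ⟨ih1, ih2⟩ := ih (by omega)
    have hpj : 0 < p j := ih2.trans_le (h3 j)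
    have hj1 : ((j + 1 : ℕ) : ℝ) / r < 1 := (div_lt_one hr').2 (by exact_mod_cast hj)
    have key : (1 - ((j + 1 : ℕ) : ℝ) / r) * p (j + 1) ≤ p (j + 1 + 1) := by
      have h5 : ((j : ℝ) + 1) * p (j + 1) * ((1 - (j : ℝ) / r) * p j) ≤
          p j * (p (j + 1) + j * p (j + 2)) :=
        (mul_le_mul_of_nonneg_left ih1 (by positivity)).trans
          ((by ring : _ = ((j : ℝ) + 1) * p (j + 1) ^ 2).trans_le (h4 j))
      have h6 : (p j * j) * ((1 - ((j + 1 : ℕ) : ℝ) / r) * p (j + 1)) ≤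
          (p j * j) * p (j + 1 + 1) := by
        have : (p j * j) * ((1 - ((j + 1 : ℕ) : ℝ) / r) * p (j + 1)) =
            ((j : ℝ) + 1) * p (j + 1) * ((1 - (j : ℝ) / r) * p j) - p j * p (j + 1) := by
          push_cast
          field_simp
          ring
        rw [this]
        linarith
      exact le_of_mul_le_mul_left h6 (by positivity)
    exact ⟨key, (mul_pos (by linarith) ih2).trans_le key⟩

/-- Obtained by chaining the ratio bounds from 2 to `t`. Keeping `p 2` on the right lets a large `p
t` bound `p 2` from below. -/
lemma le_turanDensity_mul (hp : p ∈ moonMoserSet) (hr : 1 ≤ r) (h : p (r + 1) ≤ 0) {t : ℕ}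
    (ht : 2 ≤ t) (htr : t ≤ r) : p t * (1 - 1 / (r : ℝ)) ≤ turanDensity r t * p 2 := by
  induction t, ht using Nat.le_induction with
  | base => rw [turanDensity_two, mul_comm]
  | succ t ht ih =>
    have h1 := moonMoser_ratio_le hp hr h (j := t) (by omega)
    have hr' : (0 : ℝ) < r := by exact_mod_cast hr
    have hr1 : 1 / (r : ℝ) ≤ 1 := by rw [div_le_one hr']; exact_mod_cast hr
    have ht1 : (t : ℝ) / r ≤ 1 := (div_le_one hr').2 (by exact_mod_cast (by omega : t ≤ r))
    rw [turanDensity_succ]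
    calc _ ≤ (1 - (t : ℝ) / r) * p t * (1 - 1 / (r : ℝ)) :=
          mul_le_mul_of_nonneg_right h1 (by linarith)
      _ = (1 - (t : ℝ) / r) * (p t * (1 - 1 / (r : ℝ))) := by ring
      _ ≤ (1 - (t : ℝ) / r) * (turanDensity r t * p 2) :=
          mul_le_mul_of_nonneg_left (ih (by omega)) (by linarith)
      _ = _ := by ring

/-- Few `(r + 1)`-cliques and almost as many `t`-cliques as in the Turán graph force almost as many
edges as in the Turán graph, and not many more `t`-cliques. -/
theorem exists_moonMoser_stability {t : ℕ} (ht : 2 ≤ t) (htr : t ≤ r) {ε : ℝ} (hε : 0 < ε) :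
    ∃ η : ℝ, 0 < η ∧ ∀ p ∈ moonMoserSet, p (r + 1) ≤ η → turanDensity r t - η ≤ p t →
      1 - 1 / (r : ℝ) - ε < p 2 ∧ p t < turanDensity r t + ε := by
  have hr' : (1 : ℝ) < r := by exact_mod_cast (by omega : 1 < r)
  have hr1 : 1 / (r : ℝ) < 1 := by rw [div_lt_one (by linarith)]; exact hr'
  obtain ⟨η, hη, H⟩ := exists_pos_of_isCompact isCompact_moonMoserSet
    (φ := fun p => max (p (r + 1)) (turanDensity r t - p t))
    (ψ := fun p => max (1 - 1 / (r : ℝ) - ε - p 2) (p t - turanDensity r t - ε))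
    (by fun_prop) (by fun_prop) (fun p hp hle => by
      obtain ⟨h1, h2⟩ := max_le_iff.1 hle
      have h3 := le_turanDensity_mul hp (by omega) h1 ht htr
      have h4 := moonMoser_ratio_le hp (by omega) h1 (j := 1) (by omega)
      rw [hp.2.1, Nat.cast_one, mul_one] at h4
      have hT := turanDensity_pos htr
      refine max_lt ?_ ?_
      · have : turanDensity r t * (1 - 1 / (r : ℝ)) ≤ turanDensity r t * p 2 :=
          (mul_le_mul_of_nonneg_right (by linarith) (by linarith)).trans h3
        have := le_of_mul_le_mul_left this hT
        linarith
      · have : p t * (1 - 1 / (r : ℝ)) ≤ turanDensity r t * (1 - 1 / (r : ℝ)) :=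
          h3.trans (mul_le_mul_of_nonneg_left h4 hT.le)
        have := le_of_mul_le_mul_right this (by linarith)
        linarith)
  refine ⟨η, hη, fun p hp h1 h2 => ?_⟩
  obtain ⟨h3, h4⟩ := max_lt_iff.1 (H p hp (max_le h1 (by linarith)))
  exact ⟨by linarith, by linarith⟩

/-- Few `(r + 1)`-cliques and almost as many edges as in the Turán graph force an almost extremal
ratio of the numbers of `r`-cliques and `(r - 1)`-cliques; here `r = m + 1`. -/
theorem exists_moonMoser_ratio_stability {m : ℕ} (hm : 1 ≤ m) {ε : ℝ} (hε : 0 < ε) :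
    ∃ η : ℝ, 0 < η ∧ ∀ p ∈ moonMoserSet, p (m + 2) ≤ η →
      1 - 1 / ((m + 1 : ℕ) : ℝ) - η ≤ p 2 →
      p m * p (m + 1) - (m + 1) * p (m + 1) ^ 2 + 2 * (m + 1) * (p m * p (m + 2)) <
        ε * (p m * p (m + 1)) := by
  obtain ⟨η, hη, H⟩ := exists_pos_of_isCompact isCompact_moonMoserSet
    (φ := fun p => max (p (m + 2)) (1 - 1 / ((m + 1 : ℕ) : ℝ) - p 2))
    (ψ := fun p => p m * p (m + 1) - (m + 1) * p (m + 1) ^ 2 + 2 * (m + 1) * (p m * p (m + 2)) -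
        ε * (p m * p (m + 1)))
    (by fun_prop) (by fun_prop) (fun p hp hle => by
      obtain ⟨h1, h2⟩ := max_le_iff.1 hle
      have h5 := hp.2.2.1 (m + 2)
      obtain ⟨h3, h4⟩ := moonMoser_ratio_ge (r := m + 1) hp (by omega) (by linarith) (j := m)
        (by omega)
      have hm0 : 0 < p m := h4.trans_le (hp.2.2.2.1 m)
      have h6 : p (m + 2) = 0 := le_antisymm h1 h5
      rw [h6]
      -- With `p (m + 2) = 0` this makes the left side nonpositive, while the right side is strictly
      -- positive.
      have h7 : p m ≤ (m + 1) * p (m + 1) := by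
        have : (1 - (m : ℝ) / ((m + 1 : ℕ) : ℝ)) * p m = p m / (m + 1) := by
          push_cast
          field_simp
          ring
        rw [this, div_le_iff₀ (by positivity)] at h3
        linarith
      have h8 := mul_le_mul_of_nonneg_right h7 h4.le
      have h9 : 0 < ε * (p m * p (m + 1)) := by positivity
      nlinarith)
  refine ⟨η, hη, fun p hp h1 h2 => ?_⟩
  have := H p hp (max_le h1 (by linarith))
  linarith

end MoonMoserSequences

/-! ### Few `k`-cliques in a graph without a fixed `k`-colourable subgraph. -/

section Supersaturation

open Finset
open scoped Classical

lemma pow_sum_div_card_le {α : Type*} [Fintype α] [Nonempty α] {h : α → ℝ} (hh : ∀ a, 0 ≤ h a)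
    (S : ℕ) : ((∑ a, h a) / Fintype.card α) ^ S ≤ (∑ a, h a ^ S) / Fintype.card α := by
  have hc : (0 : ℝ) < Fintype.card α := by exact_mod_cast Fintype.card_pos
  have := Real.pow_arith_mean_le_arith_mean_pow univ (fun _ : α => 1 / (Fintype.card α : ℝ)) h
    (fun _ _ => by positivity) (by simp) (fun a _ => hh a) S
  simp only [← mul_sum] at this
  rw [div_eq_inv_mul, div_eq_inv_mul]
  simpa using this

/-- Passing to blow-ups of a `k`-partite pattern: the density of the complete `k`-partite pattern
with parts indexed by `W` is at least a power of the density of the pattern itself. -/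
theorem pow_density_le_blowup {V W : Type*} [Fintype V] [Nonempty V] [Fintype W] (k : ℕ)
    (f : (Fin k → V) → ℝ) (hf : ∀ c, 0 ≤ f c) :
    ((∑ c, f c) / (Fintype.card V : ℝ) ^ k) ^ (Fintype.card W ^ k) ≤
      (∑ X : Fin k → W → V, ∏ σ : Fin k → W, f fun i => X i (σ i)) /
        ((Fintype.card V : ℝ) ^ Fintype.card W) ^ k := by
  induction k with
  | zero =>
    simp only [pow_zero, pow_one, div_one, univ_unique, sum_singleton, prod_singleton]
    exact le_of_eq (congrArg f (Subsingleton.elim _ _))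
  | succ k ih =>
    set n : ℝ := (Fintype.card V : ℝ) with hn_def
    set S := Fintype.card W
    have hn : 0 < n := Nat.cast_pos.2 Fintype.card_pos
    let g : V → (Fin k → W → V) → ℝ := fun x X => ∏ σ : Fin k → W, f (Fin.cons x fun i => X i (σ i))
    have hg : ∀ x X, 0 ≤ g x X := fun x X => prod_nonneg fun σ _ => hf _
    have hcard : (Fintype.card (Fin k → W → V) : ℝ) = (n ^ S) ^ k := by simp [n, S]
    have e1 : ∑ X : Fin (k + 1) → W → V, ∏ σ : Fin (k + 1) → W, f (fun i => X i (σ i)) =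
        ∑ X : Fin k → W → V, (∑ x, g x X) ^ S := by
      rw [← (Fin.consEquiv fun _ => W → V).sum_comp, Fintype.sum_prod_type, sum_comm]
      refine sum_congr rfl fun X _ => ?_
      have : (∑ x, g x X) ^ S = ∏ _a : W, ∑ x, g x X := by simp [S]
      rw [this, Fintype.prod_sum]
      refine sum_congr rfl fun X₀ _ => ?_
      rw [← (Fin.consEquiv fun _ => W).prod_comp, Fintype.prod_prod_type]
      refine prod_congr rfl fun a _ => prod_congr rfl fun σ _ => congrArg f ?_
      funext i
      refine Fin.cases ?_ (fun i => ?_) i <;> simp [Fin.consEquiv]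
    have e2 : ∑ c, f c = ∑ x, ∑ c : Fin k → V, f (Fin.cons x c) := by
      rw [← (Fin.consEquiv fun _ => V).sum_comp, Fintype.sum_prod_type]
      rfl
    -- Two uses of Jensen surround the induction hypothesis, which is applied with the first
    -- coordinate `x` fixed: `h2` averages over `x`, and `h1` then makes `S` copies of that
    -- coordinate.
    have h1 := pow_sum_div_card_le (α := Fin k → W → V) (h := fun X => (∑ x, g x X) / n)
      (fun X => div_nonneg (sum_nonneg fun x _ => hg x X) hn.le) S
    have h2 := pow_sum_div_card_le (α := V)
      (h := fun x => (∑ c : Fin k → V, f (Fin.cons x c)) / n ^ k)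
      (fun x => div_nonneg (sum_nonneg fun c _ => hf _) (by positivity)) (S ^ k)
    have h3 : ∑ x, ((∑ c : Fin k → V, f (Fin.cons x c)) / n ^ k) ^ S ^ k ≤
        ∑ x, (∑ X, g x X) / (n ^ S) ^ k := sum_le_sum fun x _ => ih _ fun c => hf _
    have h4 : (∑ X, (∑ x, g x X) / n) / (n ^ S) ^ k = (∑ x, (∑ X, g x X) / (n ^ S) ^ k) / n := by
      rw [← sum_div, ← sum_div, sum_comm, div_right_comm]
    rw [hcard, h4] at h1
    calc ((∑ c, f c) / n ^ (k + 1)) ^ S ^ (k + 1)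
        = (((∑ x, (∑ c : Fin k → V, f (Fin.cons x c)) / n ^ k) / n) ^ S ^ k) ^ S := by
          rw [e2, ← sum_div, div_div, ← pow_mul, pow_succ, pow_succ S k]
      _ ≤ ((∑ x, (∑ X, g x X) / (n ^ S) ^ k) / n) ^ S := by
          refine pow_le_pow_left₀ ?_ (h2.trans ?_) S
          · exact pow_nonneg (div_nonneg (sum_nonneg fun x _ => div_nonneg
              (sum_nonneg fun c _ => hf _) (by positivity)) hn.le) _
          · exact div_le_div_of_nonneg_right h3 hn.le
      _ ≤ _ := h1
      _ = _ := by
          rw [e1]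
          simp_rw [div_pow]
          rw [← sum_div, div_div, pow_succ, mul_comm (n ^ S)]

lemma card_mul_card_eq_le {V I : Type*} [Fintype V] [Fintype I] [DecidableEq I] {p q : I} (hpq : p ≠ q) :
    Fintype.card V * #{g : I → V | g p = g q} ≤ Fintype.card V ^ Fintype.card I := by
  rw [← Fintype.card_fun, ← card_univ, ← card_product, ← card_univ]
  refine card_le_card_of_injOn (fun y => Function.update y.2 p y.1) (by simp) ?_
  rintro ⟨v, g⟩ hg ⟨v', g'⟩ hg' h
  simp only [coe_product, coe_univ, coe_filter, mem_univ, true_and, Set.mem_prod,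
    Set.mem_univ, Set.mem_ofPred_eq] at hg hg'
  have h1 : v = v' := by simpa using congrFun h p
  have h2 : ∀ i, i ≠ p → g i = g' i := fun i hi => by simpa [hi] using congrFun h i
  refine Prod.ext h1 (funext fun i => ?_)
  by_cases hi : i = p
  · subst hi
    exact hg.trans ((h2 q hpq.symm).trans hg'.symm)
  · exact h2 i hi

/-- A graph without a copy of a fixed `k`-colourable graph has few `k`-cliques. -/
theorem pow_cliqueSum_le_of_free {V W : Type*} [Fintype V] [Nonempty V] [Fintype W]
    {G : SimpleGraph V} {H : SimpleGraph W} {k : ℕ} (col : H.Coloring (Fin k)) (hfree : H.Free G) :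
    (cliqueSum G (fun _ => 1 / (Fintype.card V : ℝ)) k) ^ (Fintype.card W ^ k) ≤
      (Fintype.card W : ℝ) ^ 2 / Fintype.card V := by
  set n : ℝ := (Fintype.card V : ℝ) with hn_def
  set S := Fintype.card W
  have hn : 0 < n := Nat.cast_pos.2 Fintype.card_pos
  have h0 : cliqueSum G (fun _ => 1 / n) k =
      (∑ c : Fin k → V, tupleWeight G (fun _ => 1) c) / n ^ k := by
    have := cliqueSum_smul (G := G) (w := fun _ => 1) (1 / n) k
    simp only [mul_one] at this
    rw [this, one_div, inv_pow, inv_mul_eq_div, cliqueSum]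
  have hle : ∀ X : Fin k → W → V,
      (∏ σ : Fin k → W, tupleWeight G (fun _ => 1) fun i => X i (σ i)) ≤
      ∑ ab : W × W, if ab.1 ≠ ab.2 ∧ X (col ab.1) ab.1 = X (col ab.2) ab.2 then 1 else 0 := by
    intro X
    have hnn : ∀ ab : W × W, (0 : ℝ) ≤
        if ab.1 ≠ ab.2 ∧ X (col ab.1) ab.1 = X (col ab.2) ab.2 then 1 else 0 := fun ab => by
      split_ifs <;> norm_num
    by_cases hall : ∀ σ : Fin k → W, IsCliqueTuple G fun i => X i (σ i)
    · have hprod : (∏ σ : Fin k → W, tupleWeight G (fun _ => 1) fun i => X i (σ i)) = 1 :=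
        prod_eq_one fun σ _ => by simp [tupleWeight, hall σ]
      -- If all transversals are cliques, then `a ↦ X (col a) a` preserves adjacency, so injectivity
      -- would give a copy of `H`. The selection below passes through both ends of a given edge.
      have hinj : ¬ Function.Injective fun a => X (col a) a := fun hinj => by
        refine hfree ⟨⟨⟨fun a => X (col a) a, fun {a b} hab => ?_⟩, hinj⟩⟩
        have hc := col.valid hab
        have := hall (fun i => if i = col a then a else b) (col a) (col b) hc
        simpa [hc.symm] using this
      simp only [Function.Injective, not_forall] at hinj
      obtain ⟨a, b, hab, hne⟩ := hinj
      rw [hprod]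
      refine le_trans (le_of_eq ?_) (single_le_sum (fun ab _ => hnn ab) (mem_univ (a, b)))
      simp [hne, hab]
    · push Not at hall
      obtain ⟨σ, hσ⟩ := hall
      rw [prod_eq_zero (mem_univ σ) (by simp [tupleWeight, hσ])]
      exact sum_nonneg fun ab _ => hnn ab
  have hpair : ∀ ab : W × W, (∑ X : Fin k → W → V,
      if ab.1 ≠ ab.2 ∧ X (col ab.1) ab.1 = X (col ab.2) ab.2 then (1 : ℝ) else 0) ≤
        (n ^ S) ^ k / n := by
    rintro ⟨a, b⟩
    by_cases hab : a = b
    · simp only [hab, ne_eq, not_true_eq_false, false_and, if_false, sum_const_zero]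
      positivity
    · simp only [ne_eq, hab, not_false_eq_true, true_and]
      rw [le_div_iff₀' hn, ← (Equiv.curry (Fin k) W V).sum_comp]
      have h := card_mul_card_eq_le (V := V) (p := (col a, a)) (q := (col b, b))
        (fun h => hab (Prod.ext_iff.1 h).2)
      have h' : n * (#{g : Fin k × W → V | g (col a, a) = g (col b, b)} : ℝ) ≤
          n ^ Fintype.card (Fin k × W) := by rw [hn_def]; exact_mod_cast h
      rw [Fintype.card_prod, Fintype.card_fin, mul_comm k, pow_mul] at h'
      simpa [Function.curry] using h'
  rw [h0]
  refine (pow_density_le_blowup (W := W) k _ fun c =>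
    tupleWeight_nonneg (fun _ => zero_le_one) c).trans ?_
  rw [div_le_iff₀ (by positivity)]
  calc _ ≤ ∑ X : Fin k → W → V, ∑ ab : W × W,
        if ab.1 ≠ ab.2 ∧ X (col ab.1) ab.1 = X (col ab.2) ab.2 then (1 : ℝ) else 0 :=
        sum_le_sum fun X _ => hle X
    _ ≤ ∑ _ab : W × W, (n ^ S) ^ k / n := by
        rw [sum_comm]
        exact sum_le_sum fun ab _ => hpair ab
    _ = (S : ℝ) ^ 2 / n * (n ^ S) ^ k := by
        simp only [sum_const, card_univ, Fintype.card_prod, nsmul_eq_mul, Nat.cast_mul]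
        simp only [S]
        ring

theorem exists_cliqueSum_le_of_free {W : Type*} [Fintype W] {H : SimpleGraph W} {k : ℕ}
    (col : H.Coloring (Fin k)) {η : ℝ} (hη : 0 < η) :
    ∃ n₀ : ℕ, ∀ {V : Type*} [Fintype V] [Nonempty V] {G : SimpleGraph V},
      n₀ ≤ Fintype.card V → H.Free G →
        cliqueSum G (fun _ => 1 / (Fintype.card V : ℝ)) k ≤ η := by
  obtain ⟨n₀, hn₀⟩ := exists_nat_gt ((Fintype.card W : ℝ) ^ 2 / η ^ (Fintype.card W ^ k))
  refine ⟨n₀, fun {V} _ _ {G} hV hfree => ?_⟩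
  have hn : (0 : ℝ) < Fintype.card V := by exact_mod_cast Fintype.card_pos
  have h1 := pow_cliqueSum_le_of_free col hfree
  by_contra! h2
  have h3 := (pow_le_pow_left₀ hη.le h2.le (Fintype.card W ^ k)).trans h1
  have h4 : (n₀ : ℝ) ≤ Fintype.card V := by exact_mod_cast hV
  rw [div_lt_iff₀ (by positivity)] at hn₀
  rw [le_div_iff₀ hn] at h3
  have : (n₀ : ℝ) * η ^ (Fintype.card W ^ k) ≤ Fintype.card V * η ^ (Fintype.card W ^ k) := by
    gcongr
  linarith

end Supersaturation

/-! ### From the spectral radius to the edge density. -/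

section SpectralRadius

open Finset
open scoped Classical

variable {V : Type*} {G : SimpleGraph V}

lemma image_mem_cliqueSet_iff {t : ℕ} (i : Fin t → V) :
    univ.image i ∈ G.cliqueSet t ↔ IsCliqueTuple G i := by
  rw [SimpleGraph.mem_cliqueSet_iff, SimpleGraph.isNClique_iff]
  constructor
  · rintro ⟨h1, h2⟩ a b hab
    have hinj : Function.Injective i := by
      have : #(univ.image i) = #(univ : Finset (Fin t)) := by simpa using h2
      simpa [Set.injOn_univ] using card_image_iff.1 this
    exact h1 (by simp) (by simp) fun h => hab (hinj h)
  · intro h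
    have hinj : Function.Injective i := fun a b hab => by
      by_contra hne
      exact (h a b hne).ne hab
    refine ⟨?_, by simpa using card_image_of_injective univ hinj⟩
    intro x hx y hy hxy
    simp only [coe_image, coe_univ, Set.image_univ, Set.mem_range] at hx hy
    obtain ⟨a, rfl⟩ := hx
    obtain ⟨b, rfl⟩ := hy
    exact h a b fun hab => hxy (congrArg i hab)

variable [Fintype V]

lemma cliqueSum_mem_moonMoserSet {w : V → ℝ} (hw : ∀ x, 0 ≤ w x) (h1 : ∑ x, w x = 1) :
    cliqueSum G w ∈ moonMoserSet :=
  ⟨cliqueSum_zero, cliqueSum_one.trans h1, cliqueSum_nonneg hw, cliqueSum_succ_le hw h1,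
    moon_moser hw h1⟩

/-- Multiply the `i`-th eigenvalue equation, in moduli, by `k! * ‖x i‖` and sum over `i`; the
factorial cancels the tensor entries. -/
lemma norm_mul_sum_pow_le {k : ℕ} {c : ℂ} {x : V → ℂ}
    (hx : ∀ i, c * x i ^ k =
      ∑ j : Fin k → V, cliqueTensor G (k + 1) (Fin.cons i j) * ∏ l, x (j l)) :
    ‖c‖ * k.factorial * ∑ i, ‖x i‖ ^ (k + 1) ≤ cliqueSum G (fun i => ‖x i‖) (k + 1) := by
  have hf : (0 : ℝ) < k.factorial := by exact_mod_cast k.factorial_pos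
  have h1 : ∀ i, ‖c‖ * k.factorial * ‖x i‖ ^ (k + 1) ≤
      ∑ j : Fin k → V, tupleWeight G (fun i => ‖x i‖) (Fin.cons i j : Fin (k + 1) → V) := by
    intro i
    have h2 : ‖c‖ * ‖x i‖ ^ k ≤
        ∑ j : Fin k → V, ‖cliqueTensor G (k + 1) (Fin.cons i j)‖ * ∏ l, ‖x (j l)‖ := by
      rw [← norm_pow, ← norm_mul, hx i]
      refine (norm_sum_le _ _).trans_eq (sum_congr rfl fun j _ => ?_)
      rw [norm_mul, norm_prod]
    calc ‖c‖ * k.factorial * ‖x i‖ ^ (k + 1)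
        = (k.factorial * ‖x i‖) * (‖c‖ * ‖x i‖ ^ k) := by ring
      _ ≤ (k.factorial * ‖x i‖) *
          ∑ j : Fin k → V, ‖cliqueTensor G (k + 1) (Fin.cons i j)‖ * ∏ l, ‖x (j l)‖ :=
          mul_le_mul_of_nonneg_left h2 (by positivity)
      _ = _ := by
          rw [mul_sum]
          refine sum_congr rfl fun j _ => ?_
          unfold cliqueTensor tupleWeight
          rw [image_mem_cliqueSet_iff]
          split_ifs
          · simp [Fin.prod_univ_succ]
            field_simp
          · simp
  rw [mul_sum, cliqueSum, ← (Fin.consEquiv fun _ => V).sum_comp, Fintype.sum_prod_type]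
  exact sum_le_sum fun i _ => h1 i

/-- The modulus of an eigenvalue is bounded by a Lagrangian of the graph. -/
lemma IsEigenvalue.exists_weight {k : ℕ} {c : ℂ} (h : IsEigenvalue (cliqueTensor G (k + 1)) c) :
    ∃ w : V → ℝ, (∀ x, 0 ≤ w x) ∧ ∑ x, w x = 1 ∧
      ‖c‖ * k.factorial * ∑ i, w i ^ (k + 1) ≤ cliqueSum G w (k + 1) := by
  obtain ⟨x, hx0, hx⟩ := h
  obtain ⟨i₀, hi₀⟩ := Function.ne_iff.1 hx0
  have hY : 0 < ∑ i, ‖x i‖ :=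
    sum_pos' (fun i _ => norm_nonneg _) ⟨i₀, mem_univ _, norm_pos_iff.2 hi₀⟩
  refine ⟨fun i => (∑ i, ‖x i‖)⁻¹ * ‖x i‖, fun i => by positivity, ?_, ?_⟩
  · rw [← mul_sum, inv_mul_cancel₀ hY.ne']
  · rw [cliqueSum_smul]
    simp_rw [mul_pow]
    rw [← mul_sum, mul_left_comm]
    exact mul_le_mul_of_nonneg_left (norm_mul_sum_pow_le hx) (by positivity)

/-- A quantitative Bernoulli inequality. Summed over `v = n * w x`, where the linear terms cancel,
it gives `one_add_sqDeviation_le`. -/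
lemma sq_sub_one_le_pow {v : ℝ} (hv : 0 ≤ v) {t : ℕ} (ht : 2 ≤ t) :
    (v - 1) ^ 2 ≤ v ^ t - 1 - t * (v - 1) := by
  induction t, ht using Nat.le_induction with
  | base => norm_num; nlinarith
  | succ t ht ih =>
    have h1 : 0 ≤ v * (v ^ t - 1 - t * (v - 1)) := mul_nonneg hv ((sq_nonneg _).trans ih)
    have h2 : (2 : ℝ) ≤ t := by exact_mod_cast ht
    push_cast
    rw [pow_succ v t]
    nlinarith [mul_nonneg (sub_nonneg.2 h2) (sq_nonneg (v - 1)), sq_nonneg (v - 1)]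

lemma cliqueSum_two (w : V → ℝ) :
    cliqueSum G w 2 = ∑ x, ∑ y, if G.Adj y x then w x * w y else 0 := by
  rw [cliqueSum_succ, sum_insertNth 0, sum_comm]
  refine sum_congr rfl fun x _ => ?_
  rw [univ_unique, sum_singleton]
  simp [tupleWeight, IsCliqueTuple, nbrWeight, IsCommonNbr, mul_sum]

variable [Nonempty V] {w : V → ℝ}

variable (w) in
/-- The mean square deviation of a weight from the uniform one, relative to the latter. -/
noncomputable def sqDeviation : ℝ :=
  (∑ x, (Fintype.card V * w x - 1) ^ 2) / Fintype.card V

lemma one_add_sqDeviation_le (hw : ∀ x, 0 ≤ w x) (h1 : ∑ x, w x = 1) {k : ℕ} (hk : 1 ≤ k) :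
    1 + sqDeviation w ≤ (Fintype.card V : ℝ) ^ k * ∑ x, w x ^ (k + 1) := by
  have hn : (0 : ℝ) < Fintype.card V := Nat.cast_pos.2 Fintype.card_pos
  have h2 := sum_le_sum fun x (_ : x ∈ univ) =>
    sq_sub_one_le_pow (mul_nonneg hn.le (hw x)) (t := k + 1) (by omega)
  have h3 : ∑ x, (((Fintype.card V : ℝ) * w x) ^ (k + 1) - 1 -
      (k + 1 : ℕ) * (Fintype.card V * w x - 1)) =
        (Fintype.card V : ℝ) * ((Fintype.card V : ℝ) ^ k * ∑ x, w x ^ (k + 1) - 1) := by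
    simp only [sum_sub_distrib, ← mul_sum, mul_pow, h1]
    simp
    ring
  rw [h3] at h2
  have : sqDeviation w ≤ (Fintype.card V : ℝ) ^ k * ∑ x, w x ^ (k + 1) - 1 := by
    rw [sqDeviation, div_le_iff₀' hn]
    exact h2
  linarith

lemma card_mul_sum_sq (h1 : ∑ x, w x = 1) :
    (Fintype.card V : ℝ) * ∑ x, w x ^ 2 = 1 + sqDeviation w := by
  have hn : (0 : ℝ) < Fintype.card V := Nat.cast_pos.2 Fintype.card_pos
  have : ∑ x, ((Fintype.card V : ℝ) * w x - 1) ^ 2 =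
      (Fintype.card V : ℝ) * (Fintype.card V * ∑ x, w x ^ 2 - 1) := by
    simp only [sub_sq, sum_add_distrib, sum_sub_distrib, mul_pow, mul_one, one_pow, ← mul_sum, h1]
    simp
    ring
  rw [sqDeviation, this, mul_div_cancel_left₀ _ hn.ne']
  ring

lemma sum_abs_sub_sq_le : (∑ x, |w x - 1 / Fintype.card V|) ^ 2 ≤ sqDeviation w := by
  have hn : (0 : ℝ) < Fintype.card V := Nat.cast_pos.2 Fintype.card_pos
  have h := sq_sum_le_card_mul_sum_sq (s := univ) (f := fun x => |w x - 1 / Fintype.card V|)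
  refine h.trans_eq ?_
  rw [sqDeviation, eq_div_iff hn.ne', card_univ, mul_sum, sum_mul]
  refine sum_congr rfl fun x _ => ?_
  rw [sq_abs]
  field_simp

lemma cliqueSum_two_le (hw : ∀ x, 0 ≤ w x) (h1 : ∑ x, w x = 1) :
    cliqueSum G w 2 ≤ cliqueSum G (fun _ => 1 / (Fintype.card V : ℝ)) 2 +
      2 * ∑ x, |w x - 1 / Fintype.card V| := by
  have hn : (0 : ℝ) < Fintype.card V := Nat.cast_pos.2 Fintype.card_pos
  set u : ℝ := 1 / Fintype.card V with hu
  have hu0 : 0 < u := by positivity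
  have h2 : ∀ x y, (if G.Adj y x then w x * w y else 0) ≤
      (if G.Adj y x then u * u else 0) + (|w x - u| * w y + u * |w y - u|) := fun x y => by
    have h3 := mul_le_mul_of_nonneg_right (le_abs_self (w x - u)) (hw y)
    have h4 := mul_le_mul_of_nonneg_left (le_abs_self (w y - u)) hu0.le
    split_ifs
    · nlinarith
    · have := hw y
      positivity
  rw [cliqueSum_two, cliqueSum_two]
  refine (sum_le_sum fun x _ => sum_le_sum fun y _ => h2 x y).trans_eq ?_
  simp only [sum_add_distrib, ← mul_sum, h1, ← sum_mul]
  simp [hu]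
  ring

/-- Cauchy–Schwarz over ordered cliques. It transfers scarcity of `(r+1)`-cliques from the uniform
weight to `w`. -/
lemma cliqueSum_sq_le (h1 : ∑ x, w x = 1) (s : ℕ) :
    cliqueSum G w s ^ 2 ≤
      cliqueSum G (fun _ => 1 / (Fintype.card V : ℝ)) s * (1 + sqDeviation w) ^ s := by
  have hn : (0 : ℝ) < Fintype.card V := Nat.cast_pos.2 Fintype.card_pos
  have hu : cliqueSum G (fun _ => 1 / (Fintype.card V : ℝ)) s =
      (∑ c : Fin s → V, tupleWeight G (fun _ => 1) c) / (Fintype.card V : ℝ) ^ s := by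
    have := cliqueSum_smul (G := G) (w := fun _ => 1) (1 / (Fintype.card V : ℝ)) s
    simp only [mul_one] at this
    rw [this, one_div, inv_pow, inv_mul_eq_div, cliqueSum]
  have cs := sum_sq_le_sum_mul_sum_of_sq_le_mul (univ : Finset (Fin s → V))
    (r := fun c => tupleWeight G w c) (f := fun c => tupleWeight G (fun _ => 1) c)
    (g := fun c => ∏ i, w (c i) ^ 2)
    (fun c _ => tupleWeight_nonneg (fun _ => zero_le_one) c)
    (fun c _ => prod_nonneg fun i _ => sq_nonneg _)
    (fun c _ => by unfold tupleWeight; split_ifs <;> simp [prod_pow])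
  have h2 : ∑ c : Fin s → V, ∏ i, w (c i) ^ 2 = (∑ x, w x ^ 2) ^ s := by
    have := Fintype.prod_sum (fun (_ : Fin s) (x : V) => w x ^ 2)
    simpa using this.symm
  rw [← card_mul_sum_sq h1, hu, mul_pow, ← h2]
  refine cs.trans_eq ?_
  field_simp

/-- A graph with few `(r + 1)`-cliques and large `t`-clique spectral radius has many edges. -/
theorem exists_le_cliqueSum_two {r k : ℕ} (hk : 1 ≤ k) (hkr : k + 1 ≤ r) {ε : ℝ} (hε : 0 < ε) :
    ∃ δ : ℝ, 0 < δ ∧ ∀ {V : Type*} [Fintype V] [Nonempty V] {G : SimpleGraph V},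
      cliqueSum G (fun _ => 1 / (Fintype.card V : ℝ)) (r + 1) ≤ δ →
      (((r - 1).choose k : ℝ) * (1 / (r : ℝ)) ^ k - δ) * (Fintype.card V : ℝ) ^ k ≤
        spectralRadius (cliqueTensor G (k + 1)) →
      1 - 1 / (r : ℝ) - ε ≤ cliqueSum G (fun _ => 1 / (Fintype.card V : ℝ)) 2 := by
  set P := turanDensity r (k + 1) with hPdef
  have hP : 0 < P := turanDensity_pos hkr
  have hfac : (0 : ℝ) < k.factorial := by exact_mod_cast k.factorial_pos
  set τ : ℝ := ((r - 1).choose k : ℝ) * (1 / (r : ℝ)) ^ k with hτ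
  have hPτ : P = k.factorial * τ := turanDensity_eq (by omega)
  obtain ⟨ε', hε', h1, h2⟩ : ∃ ε' : ℝ, 0 < ε' ∧ ε' ≤ ε / 2 ∧ ε' ≤ P * ε ^ 2 / 64 :=
    ⟨min (ε / 2) (P * ε ^ 2 / 64), by positivity, min_le_left _ _, min_le_right _ _⟩
  obtain ⟨η, hη, H⟩ := exists_moonMoser_stability (t := k + 1) (by omega) hkr hε'
  -- `h3` keeps `P - 2 k! δ ≥ P / 2`, `h4` controls the deviation `D`, `h5` makes `p t` close enough
  -- to `P`, and `h6` absorbs the factor `(1 + D)^(r+1)`.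
  obtain ⟨δ, hδ, h3, h4, h5, h6⟩ : ∃ δ : ℝ, 0 < δ ∧ δ ≤ P / (4 * k.factorial) ∧
      δ ≤ ε' / (2 * k.factorial) ∧ δ ≤ η / (2 * k.factorial) ∧
        δ ≤ η ^ 2 * (P / 2) ^ (r + 1) :=
    ⟨min (min (P / (4 * k.factorial)) (ε' / (2 * k.factorial)))
        (min (η / (2 * k.factorial)) (η ^ 2 * (P / 2) ^ (r + 1))), by positivity,
      (min_le_left _ _).trans (min_le_left _ _), (min_le_left _ _).trans (min_le_right _ _),
      (min_le_right _ _).trans (min_le_left _ _), (min_le_right _ _).trans (min_le_right _ _)⟩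
  rw [le_div_iff₀ (by positivity)] at h3 h4 h5
  refine ⟨δ, hδ, fun {V} _ _ {G} hK hρ => ?_⟩
  have hn : (0 : ℝ) < Fintype.card V := Nat.cast_pos.2 Fintype.card_pos
  have hnk : (0 : ℝ) < (Fintype.card V : ℝ) ^ k := by positivity
  have hτδ : 0 < τ - δ := by
    have : 0 < k.factorial * (τ - δ) := by rw [mul_sub, ← hPτ]; linarith
    exact pos_of_mul_pos_right this hfac.le
  -- The second `δ` pays for not knowing that the supremum is attained. The set is nonempty because
  -- `sSup ∅ = 0` while the radius is positive.
  obtain ⟨c, hc, hlt⟩ : ∃ c : ℂ, IsEigenvalue (cliqueTensor G (k + 1)) c ∧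
      (τ - 2 * δ) * (Fintype.card V : ℝ) ^ k < ‖c‖ := by
    have hlt : (τ - 2 * δ) * (Fintype.card V : ℝ) ^ k < spectralRadius (cliqueTensor G (k + 1)) :=
      (mul_lt_mul_of_pos_right (by linarith) hnk).trans_le hρ
    have hpos : 0 < spectralRadius (cliqueTensor G (k + 1)) := (mul_pos hτδ hnk).trans_le hρ
    rw [spectralRadius] at hlt hpos
    have hne : {s : ℝ | ∃ c : ℂ, IsEigenvalue (cliqueTensor G (k + 1)) c ∧ s = ‖c‖}.Nonempty := by
      by_contra hemp
      rw [Set.not_nonempty_iff_eq_empty] at hemp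
      rw [hemp, Real.sSup_empty] at hpos
      exact lt_irrefl _ hpos
    obtain ⟨s, ⟨c, hc, rfl⟩, hs⟩ := exists_lt_of_lt_csSup hne hlt
    exact ⟨c, hc, hs⟩
  obtain ⟨w, hw, hw1, hle⟩ := hc.exists_weight
  have hmem := cliqueSum_mem_moonMoserSet (G := G) hw hw1
  set D := sqDeviation w with hD
  have hD0 : 0 ≤ D := div_nonneg (sum_nonneg fun x _ => sq_nonneg _) hn.le
  have hM := one_add_sqDeviation_le hw hw1 hk
  rw [← hD] at hM
  have hbd : (P - 2 * k.factorial * δ) * (1 + D) ≤ cliqueSum G w (k + 1) := by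
    have hS : 0 ≤ ∑ i, w i ^ (k + 1) := sum_nonneg fun i _ => pow_nonneg (hw i) _
    calc (P - 2 * k.factorial * δ) * (1 + D)
        ≤ (P - 2 * k.factorial * δ) * ((Fintype.card V : ℝ) ^ k * ∑ x, w x ^ (k + 1)) :=
          mul_le_mul_of_nonneg_left hM (by linarith)
      _ = ((τ - 2 * δ) * (Fintype.card V : ℝ) ^ k) * (k.factorial * ∑ x, w x ^ (k + 1)) := by
          rw [hPτ]; ring
      _ ≤ ‖c‖ * (k.factorial * ∑ x, w x ^ (k + 1)) :=
          mul_le_mul_of_nonneg_right hlt.le (by positivity)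
      _ ≤ _ := by rw [← mul_assoc]; exact hle
  have hD1 : 1 + D ≤ 2 / P := by
    rw [le_div_iff₀ hP]
    have := le_one_of_mem_moonMoserSet hmem (k + 1)
    nlinarith
  have hr1 : cliqueSum G w (r + 1) ≤ η := by
    refine le_of_sq_le_sq ?_ hη.le
    calc cliqueSum G w (r + 1) ^ 2 ≤ _ := cliqueSum_sq_le hw1 (r + 1)
      _ ≤ (η ^ 2 * (P / 2) ^ (r + 1)) * (2 / P) ^ (r + 1) := by
          gcongr
          exact hK.trans h6
      _ = η ^ 2 := by
          rw [mul_assoc, ← mul_pow]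
          have : P / 2 * (2 / P) = 1 := by field_simp
          rw [this, one_pow, mul_one]
  obtain ⟨h7, h8⟩ := H _ hmem hr1 (by nlinarith)
  -- `(P - 2 k! δ)(1 + D) ≤ p t < P + ε'` leaves `D * P / 2 ≤ 2 ε'`.
  have hDε : D ≤ (ε / 4) ^ 2 := by
    have : D * (P / 2) ≤ (ε / 4) ^ 2 * (P / 2) := by nlinarith
    exact le_of_mul_le_mul_right this (by positivity)
  have h9 : ∑ x, |w x - 1 / Fintype.card V| ≤ ε / 4 :=
    le_of_sq_le_sq (sum_abs_sub_sq_le.trans hDε) (by positivity)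
  have h10 := cliqueSum_two_le (G := G) hw hw1
  linarith

end SpectralRadius

/-! ### Reading a partition off a clique and matching it with the Turán graph. -/

section Stability

open Finset
open scoped Classical

variable {V : Type*} [Fintype V] {G : SimpleGraph V} {w : V → ℝ} {s m : ℕ}

variable (G w) in
/-- The total weight of the ordered edges between common neighbours of a tuple. -/
noncomputable def nbrEdgeWeight (c : Fin s → V) : ℝ :=
  ∑ x, ∑ y, if IsCommonNbr G c x ∧ IsCommonNbr G c y ∧ G.Adj y x then w x * w y else 0

variable (G w) in
/-- The total weight of the vertices that are not adjacent to all members of a tuple but one. -/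
noncomputable def missWeight (c : Fin (m + 1) → V) : ℝ := ∑ x, if MissesOne G c x then 0 else w x

lemma nbrEdgeWeight_nonneg (hw : ∀ x, 0 ≤ w x) (c : Fin s → V) : 0 ≤ nbrEdgeWeight G w c :=
  sum_nonneg fun x _ => sum_nonneg fun y _ => by
    split_ifs; exacts [mul_nonneg (hw x) (hw y), le_rfl]

lemma sum_tupleWeight_mul_nbrEdgeWeight (s : ℕ) :
    ∑ c : Fin s → V, tupleWeight G w c * nbrEdgeWeight G w c = cliqueSum G w (s + 2) := by
  rw [cliqueSum_succ, sum_insertNth 0]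
  refine sum_congr rfl fun c _ => ?_
  rw [nbrEdgeWeight, mul_sum]
  refine sum_congr rfl fun x _ => ?_
  rw [tupleWeight_insertNth, nbrWeight, mul_assoc]
  congr 1
  rw [mul_sum]
  refine sum_congr rfl fun y _ => ?_
  rw [isCommonNbr_iff_removeNth 0]
  simp only [Fin.removeNth_insertNth, Fin.insertNth_apply_same]
  by_cases h1 : IsCommonNbr G c x <;> simp [h1]

lemma missWeight_eq (h1 : ∑ x, w x = 1) (c : Fin (m + 1) → V) :
    missWeight G w c = 1 - ∑ i : Fin (m + 1), nbrWeight G w (i.removeNth c) +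
      (m + 1) * nbrWeight G w c := by
  rw [sum_nbrWeight_removeNth, ← h1, missWeight]
  have : ∑ x, w x = (∑ x, if MissesOne G c x then w x else 0) +
      ∑ x, if MissesOne G c x then 0 else w x := by
    rw [← sum_add_distrib]
    exact sum_congr rfl fun x _ => by split_ifs <;> simp
  linarith

/-- Averaged over `(m+1)`-cliques, the badly attached weight is the slack in Moon–Moser, and each
inner-edge term costs at most `cliqueSum G w (m + 2)`. The right side is what
`exists_moonMoser_ratio_stability` makes small. -/
lemma cliqueSum_mul_sum_missWeight_le (hw : ∀ x, 0 ≤ w x) (h1 : ∑ x, w x = 1) (m : ℕ) :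
    cliqueSum G w m * ∑ c : Fin (m + 1) → V, tupleWeight G w c *
        (missWeight G w c + ∑ i : Fin (m + 1), nbrEdgeWeight G w (i.removeNth c)) ≤
      cliqueSum G w m * cliqueSum G w (m + 1) - (m + 1) * cliqueSum G w (m + 1) ^ 2 +
        2 * (m + 1) * (cliqueSum G w m * cliqueSum G w (m + 2)) := by
  have e1 : ∑ c : Fin (m + 1) → V, tupleWeight G w c * missWeight G w c =
      cliqueSum G w (m + 1) - (∑ c : Fin (m + 1) → V, tupleWeight G w c *
        ∑ i : Fin (m + 1), nbrWeight G w (i.removeNth c)) + (m + 1) * cliqueSum G w (m + 2) := by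
    rw [cliqueSum_succ (m + 1), cliqueSum, mul_sum, ← sum_sub_distrib, ← sum_add_distrib]
    refine sum_congr rfl fun c _ => ?_
    rw [missWeight_eq h1]
    ring
  have e2 : ∑ c : Fin (m + 1) → V, tupleWeight G w c *
      ∑ i : Fin (m + 1), nbrEdgeWeight G w (i.removeNth c) ≤ (m + 1) * cliqueSum G w (m + 2) := by
    simp_rw [mul_sum]
    rw [sum_comm]
    have : ∀ i : Fin (m + 1), ∑ c, tupleWeight G w c * nbrEdgeWeight G w (i.removeNth c) ≤
        cliqueSum G w (m + 2) := fun i => by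
      rw [sum_tupleWeight_removeNth_const i, ← sum_tupleWeight_mul_nbrEdgeWeight]
      refine sum_le_sum fun c _ => ?_
      exact mul_le_mul_of_nonneg_right (mul_le_of_le_one_right (tupleWeight_nonneg hw c)
        (nbrWeight_le_one hw h1 c)) (nbrEdgeWeight_nonneg hw c)
    exact (sum_le_sum fun i _ => this i).trans_eq (by simp)
  have e3 := cliqueSum_sq_le_sum (G := G) hw m
  have e4 := mul_le_mul_of_nonneg_left e2 (cliqueSum_nonneg (G := G) hw m)
  simp only [mul_add, sum_add_distrib, e1]
  linarith

/-- A partition read off from a clique: the weight of the edges inside the parts is small. -/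
lemma exists_colouring_of_ratio (hw : ∀ x, 0 ≤ w x) (h1 : ∑ x, w x = 1) {ε : ℝ}
    (h : cliqueSum G w m * cliqueSum G w (m + 1) - (m + 1) * cliqueSum G w (m + 1) ^ 2 +
        2 * (m + 1) * (cliqueSum G w m * cliqueSum G w (m + 2)) <
          ε * (cliqueSum G w m * cliqueSum G w (m + 1))) :
    ∃ χ : V → Fin (m + 1),
      (∑ x, ∑ y, if χ x = χ y ∧ G.Adj y x then w x * w y else 0) ≤ 2 * ε := by
  obtain ⟨c, hc⟩ : ∃ c : Fin (m + 1) → V,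
      missWeight G w c + ∑ i : Fin (m + 1), nbrEdgeWeight G w (i.removeNth c) < ε := by
    by_contra! hall
    have h2 := mul_le_mul_of_nonneg_left (sum_le_sum fun c (_ : c ∈ univ) =>
      mul_le_mul_of_nonneg_left (hall c) (tupleWeight_nonneg (G := G) hw c))
      (cliqueSum_nonneg (G := G) hw m)
    rw [← sum_mul] at h2
    have h3 := h2.trans (cliqueSum_mul_sum_missWeight_le hw h1 m)
    have h4 : ∑ c : Fin (m + 1) → V, tupleWeight G w c = cliqueSum G w (m + 1) := rfl
    rw [h4] at h3
    linarith
  have hχ : ∃ χ : V → Fin (m + 1), ∀ x, MissesOne G c x →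
      IsCommonNbr G ((χ x).removeNth c) x := by
    refine ⟨fun x => if h : MissesOne G c x then h.choose else 0, fun x hx => ?_⟩
    simp only [hx, dif_pos]
    exact hx.choose_spec.1
  obtain ⟨χ, hχ⟩ := hχ
  refine ⟨χ, ?_⟩
  have h0 : ∀ x, 0 ≤ if MissesOne G c x then 0 else w x := fun x => by
    split_ifs; exacts [le_rfl, hw x]
  have h00 : ∀ x y (i : Fin (m + 1)), 0 ≤ if IsCommonNbr G (i.removeNth c) x ∧ IsCommonNbr G (i.removeNth c) y ∧
      G.Adj y x then w x * w y else 0 := fun x y i => by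
    split_ifs; exacts [mul_nonneg (hw x) (hw y), le_rfl]
  -- An edge inside a class either has a badly attached end or joins two common neighbours of the
  -- same `m`-subclique.
  have h2 : ∀ x y, (if χ x = χ y ∧ G.Adj y x then w x * w y else 0) ≤
      (if MissesOne G c x then 0 else w x) * w y + w x * (if MissesOne G c y then 0 else w y) +
        ∑ i : Fin (m + 1), if IsCommonNbr G (i.removeNth c) x ∧ IsCommonNbr G (i.removeNth c) y ∧
          G.Adj y x then w x * w y else 0 := fun x y => by
    have h3 : 0 ≤ ∑ i : Fin (m + 1), if IsCommonNbr G (i.removeNth c) x ∧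
        IsCommonNbr G (i.removeNth c) y ∧ G.Adj y x then w x * w y else 0 :=
      sum_nonneg fun i _ => h00 x y i
    have h4 := mul_nonneg (h0 x) (hw y)
    have h5 := mul_nonneg (hw x) (h0 y)
    by_cases hxy : χ x = χ y ∧ G.Adj y x
    · rw [if_pos hxy]
      by_cases hx : MissesOne G c x
      · by_cases hy : MissesOne G c y
        · have h6 : w x * w y ≤ ∑ i : Fin (m + 1), if IsCommonNbr G (i.removeNth c) x ∧
              IsCommonNbr G (i.removeNth c) y ∧ G.Adj y x then w x * w y else 0 := by
            refine le_trans (le_of_eq ?_)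
              (single_le_sum (fun i _ => h00 x y i) (mem_univ (χ x)))
            have h7 := hχ y hy
            rw [← hxy.1] at h7
            simp [hχ x hx, h7, hxy.2]
          simp only [hx, hy, if_true] at h4 h5 ⊢
          linarith
        · simp only [hx, hy, if_true, if_false] at h4 h5 ⊢
          linarith
      · simp only [hx, if_false] at h4 h5 ⊢
        linarith
    · rw [if_neg hxy]
      linarith
  calc _ ≤ ∑ x, ∑ y, _ := sum_le_sum fun x _ => sum_le_sum fun y _ => h2 x y
    _ = 2 * missWeight G w c + ∑ i : Fin (m + 1), nbrEdgeWeight G w (i.removeNth c) := by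
        simp only [sum_add_distrib, ← mul_sum, ← sum_mul, h1]
        unfold nbrEdgeWeight missWeight
        rw [sum_comm' (s := (univ : Finset (Fin (m + 1)))) (t := fun _ => univ) (t' := univ)
          (s' := fun _ => univ) (by simp)]
        rw [sum_congr rfl fun x (_ : x ∈ univ) => sum_comm (s := (univ : Finset V))]
        ring
    _ ≤ 2 * ε := by
        have : 0 ≤ ∑ i : Fin (m + 1), nbrEdgeWeight G w (i.removeNth c) :=
          sum_nonneg fun i _ => nbrEdgeWeight_nonneg hw _
        linarith

/-- Two colourings of equinumerous sets can be matched up to the excesses of the colour classes of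
the first one. -/
lemma exists_equiv_card_mismatch_le {U ι : Type*} [Fintype U] [Fintype ι] [DecidableEq ι]
    (hcard : Fintype.card V = Fintype.card U) (χ : V → ι) (τ : U → ι) :
    ∃ φ : V ≃ U, #{x | χ x ≠ τ (φ x)} ≤ ∑ i, (#{x | χ x = i} - #{u | τ u = i}) := by
  have : Nonempty (V ≃ U) := Fintype.card_eq.1 hcard
  obtain ⟨φ, hφ⟩ := Finite.exists_min fun φ : V ≃ U => #{x | χ x ≠ τ (φ x)}
  refine ⟨φ, ?_⟩
  have h1 : #{x | χ x ≠ τ (φ x)} = ∑ i, #{x | χ x = i ∧ τ (φ x) ≠ i} := by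
    rw [card_eq_sum_card_fiberwise (f := χ) (t := univ) (by simp)]
    refine sum_congr rfl fun i _ => congrArg card ?_
    ext x
    simp only [mem_filter, mem_univ, true_and]
    constructor
    · rintro ⟨h, rfl⟩; exact ⟨rfl, h.symm⟩
    · rintro ⟨rfl, h⟩; exact ⟨h.symm, rfl⟩
  rw [h1]
  refine sum_le_sum fun i _ => ?_
  rcases (filter (fun x => χ x = i ∧ τ (φ x) ≠ i) univ).eq_empty_or_nonempty with he | ⟨x, hx⟩
  · simp [he]
  simp only [mem_filter, mem_univ, true_and] at hx
  -- In a matching with fewest mismatches, a misplaced vertex `x` of colour `i` excludes any other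
  -- colour from the slots of `i`: swapping would improve the matching. So all slots of `i` are
  -- filled correctly, and the mismatches are the excess.
  have h2 : ∀ y, τ (φ y) = i → χ y = i := by
    by_contra! hy
    obtain ⟨y, hy1, hy2⟩ := hy
    have hxy : x ≠ y := fun h => hy2 (h ▸ hx.1)
    refine (hφ ((Equiv.swap x y).trans φ)).not_gt (card_lt_card ?_)
    refine (ssubset_iff_of_subset fun z hz => ?_).2 ⟨x, ?_, ?_⟩
    · rw [mem_filter, Equiv.trans_apply] at hz
      replace hz := hz.2
      rw [mem_filter]
      refine ⟨mem_univ _, ?_⟩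
      by_cases hzx : z = x
      · subst hzx; exact fun h => hx.2 (h.symm.trans hx.1)
      by_cases hzy : z = y
      · subst hzy; exact fun h => hy2 (h.trans hy1)
      rwa [Equiv.swap_apply_of_ne_of_ne hzx hzy] at hz
    · simp only [mem_filter, mem_univ, true_and]
      exact fun h => hx.2 (h.symm.trans hx.1)
    · rw [mem_filter, Equiv.trans_apply, Equiv.swap_apply_left, hx.1, hy1]
      simp
  have h3 : #{x | χ x = i ∧ τ (φ x) = i} = #{u | τ u = i} := by
    refine card_bij (fun x _ => φ x) (by simp) (fun a _ b _ h => φ.injective h) fun u hu => ?_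
    simp only [mem_filter, mem_univ, true_and] at hu
    refine ⟨φ.symm u, ?_, by simp⟩
    simp [hu, h2 (φ.symm u) (by simpa using hu)]
  have h4 := card_filter_add_card_filter_not (s := filter (fun x => χ x = i) univ)
    (fun x => τ (φ x) = i)
  rw [filter_filter, filter_filter, h3] at h4
  simp only [ne_eq]
  omega

lemma div_le_card_mod_eq {n r : ℕ} (i : Fin r) : n / r ≤ #{v : Fin n | (v : ℕ) % r = i} := by
  have hr : 0 < r := i.pos
  have hlt : ∀ j : Fin (n / r), r * (j : ℕ) + i < n := fun j => by
    have h1 : r * ((j : ℕ) + 1) ≤ r * (n / r) := Nat.mul_le_mul_left r j.2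
    have h2 := Nat.mul_div_le n r
    have h3 := i.2
    rw [mul_add] at h1
    omega
  have h := card_le_card_of_injOn (s := (univ : Finset (Fin (n / r))))
    (t := {v : Fin n | (v : ℕ) % r = i}) (fun j => ⟨r * j + i, hlt j⟩)
    (fun j _ => by simp [Nat.mod_eq_of_lt i.2]) (fun j _ k _ hjk => by
      simp only [Fin.mk.injEq] at hjk
      have : r * (j : ℕ) = r * k := by omega
      exact Fin.ext (Nat.eq_of_mul_eq_mul_left hr this))
  simpa using h

/-- A graph close to the complete multipartite graph of a colouring with nearly equal colour classes
is close to the Turán graph. -/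
lemma obtainedByEdits_of_colouring {r : ℕ} (hr : 0 < r) (χ : V → Fin r) {b : ℝ}
    (hb : (#{p : V × V | ¬ (χ p.1 ≠ χ p.2 ↔ G.Adj p.1 p.2)} : ℝ) + 2 * Fintype.card V *
      (∑ i, |(#{x | χ x = i} : ℝ) - Fintype.card V / r| + r) ≤ b) :
    ObtainedByEdits G (SimpleGraph.turanGraph (Fintype.card V) r) b := by
  set n := Fintype.card V with hn
  let τ : Fin n → Fin r := fun v => ⟨v % r, Nat.mod_lt _ hr⟩
  obtain ⟨φ, hφ⟩ := exists_equiv_card_mismatch_le (by simp [hn]) χ τ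
  have hmis : (#{x | χ x ≠ τ (φ x)} : ℝ) ≤ ∑ i, |(#{x | χ x = i} : ℝ) - n / r| + r := by
    have h1 : ∀ i, ((#{x | χ x = i} - #{u | τ u = i} : ℕ) : ℝ) ≤
        |(#{x | χ x = i} : ℝ) - n / r| + 1 := fun i => by
      have h2 : n / r ≤ #{u | τ u = i} := by
        simpa [τ, Fin.ext_iff] using div_le_card_mod_eq (n := n) i
      have h3 : (n : ℝ) / r ≤ (n / r : ℕ) + 1 := by
        rw [← Nat.floor_div_eq_div (K := ℝ)]
        exact (Nat.lt_floor_add_one _).le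
      have h4 : ((n / r : ℕ) : ℝ) ≤ #{u | τ u = i} := by exact_mod_cast h2
      have h5 := le_abs_self ((#{x | χ x = i} : ℝ) - n / r)
      rcases le_total (#{x | χ x = i}) (#{u | τ u = i}) with h6 | h6
      · rw [Nat.sub_eq_zero_of_le h6]
        push_cast
        positivity
      · rw [Nat.cast_sub h6]
        linarith
    calc (#{x | χ x ≠ τ (φ x)} : ℝ)
        ≤ ∑ i, ((#{x | χ x = i} - #{u | τ u = i} : ℕ) : ℝ) := by exact_mod_cast hφ
      _ ≤ ∑ i : Fin r, (|(#{x | χ x = i} : ℝ) - n / r| + 1) := sum_le_sum fun i _ => h1 i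
      _ = _ := by simp [sum_add_distrib]
  refine ⟨(SimpleGraph.turanGraph n r).comap φ, ⟨SimpleGraph.Iso.comap φ _⟩, Set.toFinite _, ?_⟩
  refine le_trans ?_ hb
  set T := (SimpleGraph.turanGraph n r).comap φ with hT
  have hTadj : ∀ x y, T.Adj x y ↔ τ (φ x) ≠ τ (φ y) := fun x y => by
    simp [hT, SimpleGraph.turanGraph, τ, Fin.ext_iff]
  let D : Finset (V × V) := {p | ¬ (χ p.1 ≠ χ p.2 ↔ G.Adj p.1 p.2)}
  let M : Finset V := {x | χ x ≠ τ (φ x)}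
  have hsub : T.edgeSet ∆ G.edgeSet ⊆
      ((D ∪ (M ×ˢ univ ∪ univ ×ˢ M)).image fun p => s(p.1, p.2) : Finset (Sym2 V)) := by
    intro e he
    induction e using Sym2.ind with
    | _ x y =>
      simp only [coe_image]
      refine ⟨(x, y), ?_, rfl⟩
      simp only [Set.mem_symmDiff, SimpleGraph.mem_edgeSet, hTadj] at he
      simp only [coe_union, coe_product, coe_univ, Set.mem_union, Set.mem_prod, Set.mem_univ,
        and_true, true_and, mem_coe, D, M, mem_filter, mem_univ]
      by_contra! hnot
      obtain ⟨h1, h2, h3⟩ := hnot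
      rw [← h2, ← h3] at he
      tauto
  have hcard : (T.edgeSet ∆ G.edgeSet).ncard ≤ #D + (#M * n + n * #M) := by
    refine (Set.ncard_le_ncard hsub (finite_toSet _)).trans ?_
    rw [Set.ncard_coe_finset]
    refine card_image_le.trans ((card_union_le _ _).trans (Nat.add_le_add_left
      ((card_union_le _ _).trans_eq ?_) _))
    simp [card_product, hn]
  calc ((T.edgeSet ∆ G.edgeSet).ncard : ℝ) ≤ (#D : ℝ) + (#M * n + n * #M) := by
        exact_mod_cast hcard
    _ = #D + 2 * n * #M := by ring
    _ ≤ _ := by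
        have := mul_le_mul_of_nonneg_left hmis (by positivity : (0 : ℝ) ≤ 2 * n)
        linarith

end Stability

/-! ### Pair counting and conclusion. -/

section Main

open Finset
open scoped Classical

lemma sum_sum_ite_eq_card_mul {V : Type*} [Fintype V] (P : V → V → Prop)
    [∀ x y, Decidable (P x y)] (a : ℝ) :
    (∑ x, ∑ y, if P x y then a else 0) = #{p : V × V | P p.1 p.2} * a := by
  rw [← Fintype.sum_prod_type', ← sum_filter, sum_const, nsmul_eq_mul]

lemma card_filter_eq_sum_sq {V ι : Type*} [Fintype V] [Fintype ι] [DecidableEq ι]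
    (χ : V → ι) :
    (#{p : V × V | χ p.1 = χ p.2} : ℝ) = ∑ i, (#{x | χ x = i} : ℝ) ^ 2 := by
  rw [card_eq_sum_card_fiberwise (f := fun p => χ p.1) (t := univ) (by simp)]
  push_cast
  refine sum_congr rfl fun i _ => ?_
  rw [sq, ← Nat.cast_mul, ← card_product]
  congr 2
  ext p
  simp only [mem_filter, mem_univ, true_and, mem_product]
  constructor
  · rintro ⟨h, rfl⟩; exact ⟨rfl, h.symm⟩
  · rintro ⟨rfl, h⟩; exact ⟨h.symm, rfl⟩

/-- Stability: few `(r + 1)`-cliques and many edges force closeness to the Turán graph. -/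
theorem exists_obtainedByEdits {r : ℕ} (hr : 2 ≤ r) {ε : ℝ} (hε : 0 < ε) :
    ∃ η : ℝ, 0 < η ∧ ∃ n₀ : ℕ, ∀ {V : Type*} [Fintype V] [Nonempty V] {G : SimpleGraph V},
      n₀ ≤ Fintype.card V →
      cliqueSum G (fun _ => 1 / (Fintype.card V : ℝ)) (r + 1) ≤ η →
      1 - 1 / (r : ℝ) - η ≤ cliqueSum G (fun _ => 1 / (Fintype.card V : ℝ)) 2 →
      ObtainedByEdits G (SimpleGraph.turanGraph (Fintype.card V) r)
        (ε * (Fintype.card V : ℝ) ^ 2) := by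
  obtain ⟨m, rfl⟩ : ∃ m, r = m + 1 := ⟨r - 1, by omega⟩
  set r : ℕ := m + 1 with hrdef
  have hr0 : (0 : ℝ) < r := by positivity
  obtain ⟨ε', hε', h1, h2⟩ : ∃ ε' : ℝ, 0 < ε' ∧ ε' ≤ ε / 20 ∧ ε' ≤ (ε / 8) ^ 2 / (3 * r) :=
    ⟨min (ε / 20) ((ε / 8) ^ 2 / (3 * r)), by positivity, min_le_left _ _, min_le_right _ _⟩
  obtain ⟨η, hη, H⟩ := exists_moonMoser_ratio_stability (m := m) (by omega) hε'
  obtain ⟨n₀, hn₀⟩ := exists_nat_gt (8 * r / ε)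
  refine ⟨min η ε', lt_min hη hε', n₀, fun {V} _ _ {G} hV hK hE => ?_⟩
  set n : ℝ := (Fintype.card V : ℝ) with hndef
  have hn : 0 < n := Nat.cast_pos.2 Fintype.card_pos
  have hu : ∀ _ : V, 0 ≤ 1 / n := fun _ => by positivity
  have hu1 : ∑ _x : V, 1 / n = 1 := by simp [n]
  have hηη := min_le_left η ε'
  have hηε := min_le_right η ε'
  obtain ⟨χ, hχ⟩ := exists_colouring_of_ratio hu hu1
    (H _ (cliqueSum_mem_moonMoserSet hu hu1) (hK.trans hηη) (by linarith))
  rw [sum_sum_ite_eq_card_mul (fun x y => χ x = χ y ∧ G.Adj y x)] at hχ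
  rw [cliqueSum_two, sum_sum_ite_eq_card_mul (fun x y => G.Adj y x)] at hE
  set A : ℝ := (#{p : V × V | χ p.1 = χ p.2 ∧ G.Adj p.2 p.1} : ℝ) with hA
  set B : ℝ := (#{p : V × V | G.Adj p.2 p.1} : ℝ) with hB
  have hA' : A ≤ 2 * ε' * n ^ 2 := by
    have : A * (1 / n * (1 / n)) = A / n ^ 2 := by field_simp
    rwa [this, div_le_iff₀ (by positivity)] at hχ
  have hB' : (1 - 1 / (r : ℝ) - ε') * n ^ 2 ≤ B := by
    have : B * (1 / n * (1 / n)) = B / n ^ 2 := by field_simp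
    rw [this] at hE
    exact (le_div_iff₀ (by positivity)).1 (by linarith : 1 - 1 / (r : ℝ) - ε' ≤ B / n ^ 2)
  set Q : ℝ := (#{p : V × V | χ p.1 = χ p.2} : ℝ) with hQ
  set D : ℝ := (#{p : V × V | ¬ (χ p.1 ≠ χ p.2 ↔ G.Adj p.1 p.2)} : ℝ) with hD
  -- Checked pair by pair; a pair inside a class that is an edge contributes 3 on both sides.
  have hcount : D + Q + B = 2 * A + n ^ 2 := by
    have hcardV : n ^ 2 = ∑ _p : V × V, (1 : ℝ) := by simp [n, sq]
    rw [hcardV, hD, hQ, hB, hA]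
    simp only [card_filter, Nat.cast_sum, mul_sum, ← sum_add_distrib]
    refine sum_congr rfl fun p _ => ?_
    rw [G.adj_comm p.2 p.1]
    by_cases h3 : χ p.1 = χ p.2 <;> by_cases h4 : G.Adj p.1 p.2 <;> norm_num [h3, h4]
  have hcount' : Q + B ≤ A + n ^ 2 := by
    have hDA : A ≤ D := by
      rw [hA, hD]
      refine Nat.cast_le.2 (card_le_card fun p => ?_)
      simp only [mem_filter, mem_univ, true_and]
      rintro ⟨h3, h4⟩
      simp [h3, h4.symm]
    linarith
  have hsumN : ∑ i : Fin r, (#{x | χ x = i} : ℝ) = n := by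
    have := card_eq_sum_card_fiberwise (s := univ) (f := χ) (t := univ) (by simp)
    rw [card_univ] at this
    rw [hndef, this]
    push_cast
    rfl
  -- The variance of the class sizes. Its nonnegativity bounds `Q` below, hence `D` above; the upper
  -- bound on `Q` from `hcount'` makes the classes nearly equal.
  have hvar : ∑ i : Fin r, ((#{x | χ x = i} : ℝ) - n / r) ^ 2 = Q - n ^ 2 / r := by
    rw [hQ, card_filter_eq_sum_sq]
    simp only [sub_sq, sum_add_distrib, sum_sub_distrib, ← sum_mul, ← mul_sum, hsumN]
    simp only [sum_const, card_univ, Fintype.card_fin, nsmul_eq_mul]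
    field_simp
    ring
  have hQ1 : n ^ 2 / r ≤ Q := by
    have : 0 ≤ ∑ i : Fin r, ((#{x | χ x = i} : ℝ) - n / r) ^ 2 := sum_nonneg fun i _ => sq_nonneg _
    linarith
  have hn2 : (1 - 1 / (r : ℝ) - ε') * n ^ 2 = n ^ 2 - n ^ 2 / r - ε' * n ^ 2 := by ring
  have habs : ∑ i : Fin r, |(#{x | χ x = i} : ℝ) - n / r| ≤ ε / 8 * n := by
    refine le_of_sq_le_sq ?_ (by positivity)
    have h3 := sq_sum_le_card_mul_sum_sq (s := (univ : Finset (Fin r)))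
      (f := fun i => |(#{x | χ x = i} : ℝ) - n / r|)
    simp only [sq_abs, card_univ, Fintype.card_fin, hvar] at h3
    refine h3.trans ?_
    have h4 : Q - n ^ 2 / r ≤ 3 * ε' * n ^ 2 := by linarith
    rw [le_div_iff₀ (by positivity)] at h2
    calc (r : ℝ) * (Q - n ^ 2 / r) ≤ r * (3 * ε' * n ^ 2) := by gcongr
      _ = (ε' * (3 * r)) * n ^ 2 := by ring
      _ ≤ (ε / 8) ^ 2 * n ^ 2 := by gcongr
      _ = (ε / 8 * n) ^ 2 := by ring
  have hrn : (r : ℝ) ≤ ε / 8 * n := by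
    have : (n₀ : ℝ) ≤ n := Nat.cast_le.2 hV
    have := (div_lt_iff₀ hε).1 (hn₀.trans_le this)
    linarith
  refine obtainedByEdits_of_colouring (by omega) χ ?_
  have hD' : D ≤ 5 * ε' * n ^ 2 := by linarith
  have h5 : 2 * n * (∑ i : Fin r, |(#{x | χ x = i} : ℝ) - n / r| + r) ≤
      2 * n * (ε / 8 * n + ε / 8 * n) := by gcongr
  have h6 : 5 * ε' * n ^ 2 ≤ 5 * (ε / 20) * n ^ 2 := by gcongr
  have h7 : 0 < ε * n ^ 2 := by positivity
  refine (add_le_add hD' h5).trans ?_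
  linarith

end Main

end CliqueTensor

theorem mainTheorem3 {W : Type*} [Finite W] (H : SimpleGraph W) (r t : ℕ)
    (ht : 2 ≤ t) (htr : t < r + 1) (hH : H.chromaticNumber = ((r + 1 : ℕ) : ℕ∞))
    (ε : ℝ) (hε : 0 < ε) :
    ∃ δ : ℝ, 0 < δ ∧ ∃ n₀ : ℕ,
      ∀ (n : ℕ), n₀ ≤ n → ∀ (V : Type*) [Fintype V], Fintype.card V = n →
        ∀ G : SimpleGraph V, H.Free G →
          (((r - 1).choose (t - 1) : ℝ) * (1 / (r : ℝ)) ^ (t - 1) - δ) * (n : ℝ) ^ (t - 1)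
              ≤ CliqueTensor.cliqueSpectralRadius G t →
          CliqueTensor.ObtainedByEdits G (SimpleGraph.turanGraph n r) (ε * (n : ℝ) ^ 2) := by
  cases nonempty_fintype W
  obtain ⟨k, rfl⟩ : ∃ k, t = k + 1 := ⟨t - 1, by omega⟩
  obtain ⟨col⟩ := SimpleGraph.chromaticNumber_le_iff_colorable.1 hH.le
  obtain ⟨η, hη, n₁, hstab⟩ := CliqueTensor.exists_obtainedByEdits (r := r) (by omega) hε
  obtain ⟨δ, hδ, hspec⟩ := CliqueTensor.exists_le_cliqueSum_two (r := r) (k := k) (by omega)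
    (by omega) hη
  obtain ⟨n₂, hfew⟩ := CliqueTensor.exists_cliqueSum_le_of_free col (lt_min hη hδ)
  -- The extra 1 makes the vertex set nonempty.
  refine ⟨δ, hδ, n₁ + n₂ + 1, ?_⟩
  rintro n hn V _ rfl G hfree hρ
  have : Nonempty V := Fintype.card_pos_iff.1 (by omega)
  have hK := hfew (by omega) hfree
  exact hstab (by omega) (hK.trans (min_le_left _ _))
    (hspec (hK.trans (min_le_right _ _)) hρ)
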